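/- **Notation.** Let $\mathcal H=\{\tau\in\mathbb C:\operatorname{Im}\tau>0\}$, with $\mathrm{SL}_2(\mathbb Z)$ acting by $\gamma.\tau=\frac{a\tau+b}{c\tau+d}$, and put $j(\gamma,\tau)=c\tau+d$ for $\gamma=\begin{pmatrix}a&b\\c&d\end{pmatrix}$. Real powers of $z\in\mathbb C\setminus\{0\}$ are $z^s=|z|^se^{is\arg z}$ with $\arg z\in(-\pi,\pi]$. Let $I_n$ be the identity matrix of size $n$, $T=\begin{pmatrix}1&1\\0&1\end{pmatrix}$, and let $\Gamma(N)$ be the principal congruence subgroup of level $N$. Let $p$ be a positive integer, let $k\in\mathbb R$ with $k>2$, and let $v:\mathrm{SL}_2(\mathbb Z)\to\{z\in\mathbb C:|z|=1\}$ be a unitary multiplier system of weight $k$. That is, $\mu(\gamma,\tau):=v(\gamma)\,j(\gamma,\tau)^k$ satisfies $\mu(\gamma_1\gamma_2,\tau)=\mu(\gamma_1,\gamma_2.\tau)\,\mu(\gamma_2,\tau)$ for all $\gamma_1,\gamma_2\in\mathrm{SL}_2(\mathbb Z)$ and $\tau\in\mathcal H$; moreover it is assumed that $v(-I_2)=(-1)^{-k}$.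 Let $\kappa\in[0,1)$ be defined by $v(T)=e^{2\pi i\kappa}$. A representation $\rho:\Gamma\to\mathrm{GL}_p(\mathbb C)$ of a subgroup $\Gamma\ni -I_2$ of finite index in $\mathrm{SL}_2(\mathbb Z)$ is called *normal* if $\rho(-I_2)=I_p$ and, whenever $\sigma\in\mathrm{SL}_2(\mathbb Z)$ and $m\in\mathbb Z_{>0}$ satisfy $\sigma T^m\sigma^{-1}\in\Gamma$, there is $n\in\mathbb Z_{>0}$ with $\left(e^{2\pi i\kappa m}\rho(\sigma T^m\sigma^{-1})\right)^n=I_p$. It is called *unitary* if every $\rho(\gamma)$ is a unitary matrix. For such $\Gamma$ and a normal unitary $\rho$, and for $\nu\in\mathbb Z_{\ge0}$, $\xi\in\mathcal H$ and $u\in\mathbb C^p$, the elliptic vector-valued Poincaré series (VVPS) is $$\Phi_{k,\rho,\Gamma,\nu,\xi,u}(\tau)=\sum_{\gamma\in\langle -I_2\rangle\backslash\Gamma}v(\gamma)^{-1}j(\gamma,\tau)^{-k}\rho(\gamma)^{-1}f(\gamma.\tau),\qquad f(\tau)=\frac{(\tau-\xi)^\nu}{(\tau-\overline\xi)^{\nu+k}}\,u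 .$$ The summands do not depend on the choice of coset representatives. For $a,b>0$, the median $\mathrm M_{B(a,b)}\in(0,1)$ of the beta distribution $B(a,b)$ is the unique $m\in(0,1)$ with $$\int_0^m x^{a-1}(1-x)^{b-1}\,dx=\int_m^1x^{a-1}(1-x)^{b-1}\,dx .$$ **Theorem.** Let $N\ge2$ be an integer and let $\Gamma\ni-I_2$ be a subgroup of finite index in $\langle -I_2\rangle\Gamma(N)$. Let $\rho:\Gamma\to\mathrm{GL}_p(\mathbb C)$ be a normal unitary representation, and let $k>2$ be as above, $\nu\in\mathbb Z_{\ge0}$ and $u\in\mathbb C^p\setminus\{0\}$. If $$N>\frac{4\,M^{1/2}}{1-M},\qquad M:=\mathrm M_{B\left(\frac\nu2+1,\frac k2-1\right)},$$ then $\Phi_{k,\rho,\Gamma,\nu,i,u}$ is not identically zero on $\mathcal H$. -/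

import Mathlib

open scoped MatrixGroups UpperHalfPlane

namespace VVPS

/-! ### Multiplier systems and slash actions -/

/-- The factor `j(γ, τ) = c τ + d`. -/
noncomputable def j (γ : SL(2, ℤ)) (τ : ℍ) : ℂ :=
  (γ 1 0 : ℂ) * (τ : ℂ) + (γ 1 1 : ℂ)

/-- `v` is a unitary multiplier system for `SL(2, ℤ)` of real weight `k`, satisfying the
nontriviality condition `v(-I) = (-1)^(-k)`. All powers are taken with the principal branch
of the argument, with values in `(-π, π]`. -/
structure IsUnitaryMultiplierSystem (k : ℝ) (v : SL(2, ℤ) → ℂ) : Prop where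
  norm_eq_one : ∀ γ, ‖v γ‖ = 1
  cocycle : ∀ (γ₁ γ₂ : SL(2, ℤ)) (τ : ℍ),
    v (γ₁ * γ₂) * j (γ₁ * γ₂) τ ^ (k : ℂ) =
      (v γ₁ * j γ₁ (γ₂ • τ) ^ (k : ℂ)) * (v γ₂ * j γ₂ τ ^ (k : ℂ))
  nontrivial : v (-1) = (-1 : ℂ) ^ (-(k : ℂ))

/-- The number `κ ∈ [0, 1)` such that `v(T) = exp(2πiκ)`. -/
noncomputable def kappa (v : SL(2, ℤ) → ℂ) : ℝ :=
  Int.fract ((v ModularGroup.T).arg / (2 * Real.pi))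

theorem kappa_mem (v : SL(2, ℤ) → ℂ) : kappa v ∈ Set.Ico (0 : ℝ) 1 :=
  ⟨Int.fract_nonneg _, Int.fract_lt_one _⟩

theorem exp_kappa {k : ℝ} {v : SL(2, ℤ) → ℂ} (hv : IsUnitaryMultiplierSystem k v) :
    v ModularGroup.T = Complex.exp (2 * Real.pi * Complex.I * kappa v) := by
  have h1 := Complex.norm_mul_exp_arg_mul_I (v ModularGroup.T)
  rw [hv.norm_eq_one, Complex.ofReal_one, one_mul] at h1
  rw [← h1, Complex.exp_eq_exp_iff_exists_int]
  refine ⟨⌊(v ModularGroup.T).arg / (2 * Real.pi)⌋, ?_⟩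
  have hpi : (Real.pi : ℂ) ≠ 0 := by exact_mod_cast Real.pi_ne_zero
  rw [kappa, ← Int.self_sub_floor]
  push_cast
  field_simp
  ring

/-- The weight `k` slash operator `(F|_k γ)(τ) = v(γ)⁻¹ j(γ, τ)^(-k) F(γ.τ)`. -/
noncomputable def slash (k : ℝ) (v : SL(2, ℤ) → ℂ) {p : ℕ} (F : ℍ → Fin p → ℂ)
    (γ : SL(2, ℤ)) : ℍ → Fin p → ℂ :=
  fun τ => ((v γ)⁻¹ * j γ τ ^ (-(k : ℂ))) • F (γ • τ)

/-- The slash operator `F|_{k,ρ} γ = ρ(γ)⁻¹ (F|_k γ)` of an element `γ` of `Γ`. -/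
noncomputable def slashRep (k : ℝ) (v : SL(2, ℤ) → ℂ) {p : ℕ} {Γ : Subgroup SL(2, ℤ)}
    (ρ : Γ →* GL (Fin p) ℂ) (F : ℍ → Fin p → ℂ) (γ : Γ) : ℍ → Fin p → ℂ :=
  fun τ => (((ρ γ)⁻¹ : GL (Fin p) ℂ) : Matrix (Fin p) (Fin p) ℂ).mulVec
    (slash k v F (γ : SL(2, ℤ)) τ)

/-! ### Representations -/

/-- A unitary representation: every `ρ(γ)` is a unitary matrix. -/
def IsUnitaryRep {p : ℕ} {Γ : Subgroup SL(2, ℤ)} (ρ : Γ →* GL (Fin p) ℂ) : Prop :=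
  ∀ γ : Γ, (ρ γ : Matrix (Fin p) (Fin p) ℂ) ∈ Matrix.unitaryGroup (Fin p) ℂ

/-- A normal representation (relative to the multiplier system `v`) of a group `Γ`
containing `-I`. -/
structure IsNormalRep (v : SL(2, ℤ) → ℂ) {p : ℕ} {Γ : Subgroup SL(2, ℤ)}
    (ρ : Γ →* GL (Fin p) ℂ) : Prop where
  map_neg_one : ∀ h : (-1 : SL(2, ℤ)) ∈ Γ, ρ ⟨-1, h⟩ = 1
  exists_pow_eq_one : ∀ (σ : SL(2, ℤ)) (m : ℕ), 0 < m →
    ∀ h : σ * ModularGroup.T ^ m * σ⁻¹ ∈ Γ, ∃ n : ℕ, 0 < n ∧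
      (Complex.exp (2 * Real.pi * Complex.I * kappa v * m) •
        (ρ ⟨σ * ModularGroup.T ^ m * σ⁻¹, h⟩ : Matrix (Fin p) (Fin p) ℂ)) ^ n = 1

/-! ### Poincaré series -/

/-- The vector-valued Poincaré series `∑_{γ ∈ Λ\Γ} f|_{k,ρ} γ`, a sum over the cosets `Λγ`.
The summand of a coset is computed from a representative; it does not depend on the
representative when `f|_{k,ρ} λ = f` for all `λ ∈ Λ` (see `slashRep_out`). -/
noncomputable def poincareSeries (k : ℝ) (v : SL(2, ℤ) → ℂ) {p : ℕ} {Γ : Subgroup SL(2, ℤ)}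
    (Λ : Subgroup Γ) (ρ : Γ →* GL (Fin p) ℂ) (f : ℍ → Fin p → ℂ) : ℍ → Fin p → ℂ :=
  fun τ => ∑' q : Quotient (QuotientGroup.rightRel Λ), slashRep k v ρ f q.out τ

/-- The function `τ ↦ (τ - ξ)^ν / (τ - ξ̄)^(ν + k) u`. -/
noncomputable def ellipticSeed (k : ℝ) {p : ℕ} (ν : ℕ) (ξ : ℍ) (u : Fin p → ℂ) :
    ℍ → Fin p → ℂ :=
  fun τ => (((τ : ℂ) - ξ) ^ ν /
    ((τ : ℂ) - (starRingEnd ℂ) (ξ : ℂ)) ^ ((ν : ℂ) + (k : ℂ))) • u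

/-- The elliptic vector-valued Poincaré series `Φ_{k,ρ,Γ,ν,ξ,u}`, a sum over `⟨-I⟩\Γ`. -/
noncomputable def ellipticPoincare (k : ℝ) (v : SL(2, ℤ) → ℂ) {p : ℕ}
    {Γ : Subgroup SL(2, ℤ)} (ρ : Γ →* GL (Fin p) ℂ) (ν : ℕ) (ξ : ℍ) (u : Fin p → ℂ) :
    ℍ → Fin p → ℂ :=
  poincareSeries k v ((Subgroup.zpowers (-1 : SL(2, ℤ))).subgroupOf Γ) ρ
    (ellipticSeed k ν ξ u)

/-! ### Independence of coset representatives -/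

theorem j_ne_zero (γ : SL(2, ℤ)) (τ : ℍ) : j γ τ ≠ 0 := by
  have := UpperHalfPlane.denom_ne_zero (γ : GL (Fin 2) ℝ) τ
  simpa [j, UpperHalfPlane.denom] using this

theorem slash_mul {k : ℝ} {v : SL(2, ℤ) → ℂ} (hv : IsUnitaryMultiplierSystem k v) {p : ℕ}
    (F : ℍ → Fin p → ℂ) (γ₁ γ₂ : SL(2, ℤ)) :
    slash k v F (γ₁ * γ₂) = slash k v (slash k v F γ₁) γ₂ := by
  funext τ
  have h := hv.cocycle γ₁ γ₂ τ
  have hs : (γ₁ * γ₂) • τ = γ₁ • γ₂ • τ := SemigroupAction.mul_smul γ₁ γ₂ τ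
  simp only [slash, Complex.cpow_neg, hs]
  rw [smul_smul (M := ℂ)]
  congr 1
  rw [← mul_inv, h]
  simp only [mul_inv]
  ring

theorem slashRep_mul {k : ℝ} {v : SL(2, ℤ) → ℂ} (hv : IsUnitaryMultiplierSystem k v) {p : ℕ}
    {Γ : Subgroup SL(2, ℤ)} (ρ : Γ →* GL (Fin p) ℂ) (F : ℍ → Fin p → ℂ) (γ₁ γ₂ : Γ) :
    slashRep k v ρ F (γ₁ * γ₂) = slashRep k v ρ (slashRep k v ρ F γ₁) γ₂ := by
  funext τ
  simp only [slashRep, Subgroup.coe_mul, slash_mul hv, map_mul, mul_inv_rev, Units.val_mul]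
  rw [← Matrix.mulVec_mulVec]
  simp only [slash, slashRep, Matrix.mulVec_smul]

theorem slashRep_out {k : ℝ} {v : SL(2, ℤ) → ℂ} (hv : IsUnitaryMultiplierSystem k v) {p : ℕ}
    {Γ : Subgroup SL(2, ℤ)} (Λ : Subgroup Γ) (ρ : Γ →* GL (Fin p) ℂ) (f : ℍ → Fin p → ℂ)
    (hf : ∀ l ∈ Λ, slashRep k v ρ f l = f) (γ : Γ) :
    slashRep k v ρ f (Quotient.mk (QuotientGroup.rightRel Λ) γ).out = slashRep k v ρ f γ := by
  have h := Quotient.mk_out (s := QuotientGroup.rightRel Λ) γ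
  have h2 := (QuotientGroup.rightRel_apply (s := Λ)).1 h
  set g := (Quotient.mk (QuotientGroup.rightRel Λ) γ).out
  have h3 : γ = (γ * g⁻¹) * g := by group
  conv_rhs => rw [h3, slashRep_mul hv, hf _ h2]

/-- For a normal representation every function is invariant under `⟨-I⟩`. -/
theorem slashRep_zpowers {k : ℝ} {v : SL(2, ℤ) → ℂ} (hv : IsUnitaryMultiplierSystem k v)
    {p : ℕ} {Γ : Subgroup SL(2, ℤ)} {ρ : Γ →* GL (Fin p) ℂ} (hρ : IsNormalRep v ρ)
    (f : ℍ → Fin p → ℂ) :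
    ∀ l ∈ (Subgroup.zpowers (-1 : SL(2, ℤ))).subgroupOf Γ, slashRep k v ρ f l = f := by
  have key : ∀ h : (-1 : SL(2, ℤ)) ∈ Γ, slashRep k v ρ f ⟨-1, h⟩ = f := by
    intro h
    funext τ
    have hj : j (-1) τ = -1 := by simp [j]
    have hsm : (-1 : SL(2, ℤ)) • τ = τ := by
      ext
      simp
    have h0 : (-1 : ℂ) ^ (-(k : ℂ)) ≠ 0 := by
      simp [Complex.cpow_eq_zero_iff]
    simp only [slashRep, slash, hρ.map_neg_one h, hv.nontrivial, hj, hsm, inv_one,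
      Units.val_one, Matrix.one_mulVec]
    rw [inv_mul_cancel₀ h0, one_smul]
  rintro ⟨l, hl⟩ hmem
  rw [Subgroup.mem_subgroupOf] at hmem
  obtain ⟨n, hn⟩ := hmem
  simp only at hn
  rcases Int.even_or_odd n with he | ho
  · have h1 : l = 1 := by rw [← hn, he.neg_one_zpow]
    have hjj : slash k v f 1 = f := by
      have hone : v 1 = 1 := by
        have h := hv.cocycle 1 1 UpperHalfPlane.I
        have hnz : v 1 ≠ 0 := by
          intro h0; have := hv.norm_eq_one 1; simp [h0] at this
        simpa [j, hnz] using h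
      funext τ
      simp [slash, j, hone]
    subst h1
    funext τ
    have : (⟨1, hl⟩ : Γ) = 1 := rfl
    simp [slashRep, this, hjj]
  · have h1 : l = -1 := by rw [← hn, ho.neg_one_zpow]
    subst h1
    exact key hl

/-! ### The median of a beta distribution -/

/-- `m ∈ (0, 1)` halves the integral of the (unnormalized) density of `B(a, b)`. -/
structure IsBetaMedian (a b m : ℝ) : Prop where
  pos : 0 < m
  lt_one : m < 1
  integral_eq : (∫ x in (0 : ℝ)..m, x ^ (a - 1) * (1 - x) ^ (b - 1)) =
    ∫ x in m..(1 : ℝ), x ^ (a - 1) * (1 - x) ^ (b - 1)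

/-- The median of the beta distribution `B(a, b)`: for `a, b > 0` there is exactly one number
satisfying `IsBetaMedian a b` (see `isBetaMedian_iff`), and it is selected here. -/
noncomputable def betaMedian (a b : ℝ) : ℝ :=
  sInf {m : ℝ | IsBetaMedian a b m}

theorem beta_intervalIntegrable {a b : ℝ} (ha : 0 < a) (hb : 0 < b) :
    IntervalIntegrable (fun x : ℝ => x ^ (a - 1) * (1 - x) ^ (b - 1))
      MeasureTheory.volume 0 1 := by
  have h := Complex.betaIntegral_convergent (u := a) (v := b) (by simpa) (by simpa)
  rw [intervalIntegrable_iff_integrableOn_Ioc_of_le zero_le_one] at h ⊢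
  refine MeasureTheory.IntegrableOn.congr_fun h.re (fun x hx => ?_) measurableSet_Ioc
  have h1 : (x : ℂ) ^ ((a : ℂ) - 1) = ((x ^ (a - 1) : ℝ) : ℂ) := by
    rw [Complex.ofReal_cpow hx.1.le]; push_cast; rfl
  have h2 : (1 - (x : ℂ)) ^ ((b : ℂ) - 1) = (((1 - x) ^ (b - 1) : ℝ) : ℂ) := by
    rw [Complex.ofReal_cpow (by linarith [hx.2])]; push_cast; rfl
  simp only [h1, h2, ← Complex.ofReal_mul]
  exact Complex.ofReal_re _

theorem existsUnique_isBetaMedian {a b : ℝ} (ha : 0 < a) (hb : 0 < b) :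
    ∃! m, IsBetaMedian a b m := by
  set g : ℝ → ℝ := fun x => x ^ (a - 1) * (1 - x) ^ (b - 1) with hg
  have hint := beta_intervalIntegrable ha hb
  have hsub : ∀ x y : ℝ, 0 ≤ x → x ≤ y → y ≤ 1 →
      IntervalIntegrable g MeasureTheory.volume x y := fun x y hx hxy hy =>
    hint.mono_set (by
      rw [Set.uIcc_of_le hxy, Set.uIcc_of_le zero_le_one]
      exact Set.Icc_subset_Icc hx hy)
  have hpos : ∀ x y : ℝ, 0 ≤ x → x < y → y ≤ 1 → 0 < ∫ t in x..y, g t := by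
    intro x y hx hxy hy
    refine intervalIntegral.intervalIntegral_pos_of_pos_on (hsub x y hx hxy.le hy) ?_ hxy
    intro t ht
    exact mul_pos (Real.rpow_pos_of_pos (by linarith [ht.1]) _)
      (Real.rpow_pos_of_pos (by linarith [ht.2]) _)
  have hadd : ∀ x y z : ℝ, 0 ≤ x → x ≤ y → y ≤ z → z ≤ 1 →
      (∫ t in x..y, g t) + ∫ t in y..z, g t = ∫ t in x..z, g t := by
    intro x y z h1 h2 h3 h4
    exact intervalIntegral.integral_add_adjacent_intervals
      (hsub x y h1 h2 (h3.trans h4)) (hsub y z (h1.trans h2) h3 h4)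
  have hcont : ContinuousOn (fun m => ∫ t in (0 : ℝ)..m, g t) (Set.Icc 0 1) := by
    have := intervalIntegral.continuousOn_primitive_interval
      (μ := MeasureTheory.volume) (f := g) (a := 0) (b := 1)
      ((intervalIntegrable_iff' (by simp)).1 hint)
    rwa [Set.uIcc_of_le zero_le_one] at this
  have hT := hpos 0 1 le_rfl zero_lt_one le_rfl
  obtain ⟨m, hm, hmT⟩ := intermediate_value_Icc zero_le_one hcont
    (show (∫ t in (0 : ℝ)..1, g t) / 2 ∈ _ by
      simp only [intervalIntegral.integral_same]
      exact ⟨by linarith, by linarith⟩)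
  simp only at hmT
  have hm0 : 0 < m := by
    rcases hm.1.lt_or_eq with h | h
    · exact h
    · rw [← h, intervalIntegral.integral_same] at hmT; linarith
  have hm1 : m < 1 := by
    rcases hm.2.lt_or_eq with h | h
    · exact h
    · rw [h] at hmT; linarith
  have hmain : ∀ x y : ℝ, IsBetaMedian a b x → IsBetaMedian a b y → ¬ x < y := by
    intro x y hx hy hxy
    have e1 := hadd 0 x y le_rfl hx.pos.le hxy.le hy.lt_one.le
    have e2 := hadd x y 1 hx.pos.le hxy.le hy.lt_one.le le_rfl
    have e3 := hpos x y hx.pos.le hxy hy.lt_one.le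
    have e4 : (∫ t in (0 : ℝ)..x, g t) = ∫ t in x..1, g t := hx.integral_eq
    have e5 : (∫ t in (0 : ℝ)..y, g t) = ∫ t in y..1, g t := hy.integral_eq
    linarith
  refine ⟨m, ⟨hm0, hm1, ?_⟩, fun y hy => ?_⟩
  · have := hadd 0 m 1 le_rfl hm.1 hm.2 le_rfl
    change (∫ t in (0 : ℝ)..m, g t) = ∫ t in m..1, g t
    linarith
  · have hmm : IsBetaMedian a b m := by
      refine ⟨hm0, hm1, ?_⟩
      have := hadd 0 m 1 le_rfl hm.1 hm.2 le_rfl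
      change (∫ t in (0 : ℝ)..m, g t) = ∫ t in m..1, g t
      linarith
    exact le_antisymm (not_lt.1 (hmain m y hmm hy)) (not_lt.1 (hmain y m hy hmm))

theorem isBetaMedian_iff {a b : ℝ} (ha : 0 < a) (hb : 0 < b) (m : ℝ) :
    IsBetaMedian a b m ↔ m = betaMedian a b := by
  obtain ⟨m₀, h₀, huniq⟩ := existsUnique_isBetaMedian ha hb
  have hset : {m : ℝ | IsBetaMedian a b m} = {m₀} := by
    ext x
    exact ⟨fun h => huniq x h, fun h => by rw [Set.mem_singleton_iff.1 h]; exact h₀⟩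
  have hmed : betaMedian a b = m₀ := by rw [betaMedian, hset, csInf_singleton]
  rw [hmed]
  exact ⟨huniq m, fun h => h ▸ h₀⟩

end VVPS

/-! Write `t = |τ - i|² / |τ + i|²`. The function `W(τ) = |f(τ)| (Im τ)^(k/2)` depends on `t` alone
and equals a constant times `t^(ν/2) (1 - t)^(k/2)` (`seedWeight_eq`). Since `v` and `ρ` are
unitary, the term of the series at `γ` has norm `W(γ.τ) / (Im τ)^(k/2)`. If the series vanishes at
`τ`, its identity term is therefore at most the sum of the others: `W(τ) ≤ ∑ W(γ.τ)` over the
nontrivial cosets.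

This is integrated over the disc `t < R` in the hyperbolic measure. When the translates of the disc
by `Γ` modulo `±I` are pairwise disjoint, the right side is at most the integral of `W` outside the
disc (`lintegral_disc_le`). In the variable `t` the hyperbolic measure is `4π dt / (1 - t)²`, so `W`
becomes a multiple of the density of `B(ν/2 + 1, k/2 - 1)` (`setLIntegral_seedWeight`). For `R > M`
the disc carries more than half of the mass, a contradiction.

The translates are disjoint when `i` is moved far enough: `cosh d(i, γ.i)` is half the sum of the
squared entries of `γ`, hence at least `1 + N²/2` for `γ ≠ ±I` in `⟨-I⟩Γ(N)`. The disc admits any `R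
< 1` with `8R / (1 - R)² ≤ N²/2`, that is, `N ≥ 4√R / (1 - R)`; the strict hypothesis at `M` leaves
room for some `R > M`. -/

namespace VVPS

open MeasureTheory Set Complex
open scoped ENNReal

/-! ### The hyperbolic measure in the Cayley coordinate -/

/-- The squared modulus `|τ - i|² / |τ + i|²` of the Cayley transform. -/
noncomputable def cayleySq (z : ℂ) : ℝ := ‖z - I‖ ^ 2 / ‖z + I‖ ^ 2

theorem measurable_cayleySq : Measurable cayleySq := by
  unfold cayleySq
  fun_prop

theorem add_I_ne_zero (τ : ℍ) : (τ : ℂ) + I ≠ 0 := by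
  intro h
  have := congrArg Complex.im h
  have h2 := τ.im_pos
  simp at this
  linarith

theorem one_sub_cayleySq (τ : ℍ) : 1 - cayleySq τ = 4 * τ.im / ‖(τ : ℂ) + I‖ ^ 2 := by
  have h : ‖(τ : ℂ) + I‖ ^ 2 ≠ 0 := by simpa using add_I_ne_zero τ
  rw [cayleySq, eq_div_iff h, sub_mul, div_mul_cancel₀ _ h, ← Complex.normSq_eq_norm_sq,
    ← Complex.normSq_eq_norm_sq, Complex.normSq_apply, Complex.normSq_apply]
  simp
  ring

theorem cayleySq_lt_one (τ : ℍ) : cayleySq τ < 1 := by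
  have h : 0 < ‖(τ : ℂ) + I‖ := by simpa using add_I_ne_zero τ
  have := one_sub_cayleySq τ
  have h3 : 0 < 4 * τ.im / ‖(τ : ℂ) + I‖ ^ 2 := by have := τ.im_pos; positivity
  linarith

/-- The inverse Cayley transform from the unit disc to the upper half-plane. -/
noncomputable def invCayley (w : ℂ) : ℂ := I * (1 + w) / (1 - w)

theorem one_sub_ne_zero_of_mem_ball {w : ℂ} (hw : w ∈ Metric.ball (0 : ℂ) 1) : 1 - w ≠ 0 := by
  intro h
  have : w = 1 := (sub_eq_zero.1 h).symm
  simp [this] at hw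

theorem hasDerivAt_invCayley {w : ℂ} (hw : 1 - w ≠ 0) :
    HasDerivAt invCayley (2 * I / (1 - w) ^ 2) w := by
  have h1 : HasDerivAt (fun w : ℂ => I * (1 + w)) (I * 1) w :=
    ((hasDerivAt_id w).const_add 1).const_mul I
  have h2 : HasDerivAt (fun w : ℂ => 1 - w) (-1) w := (hasDerivAt_id w).const_sub 1
  have h3 : 2 * I / (1 - w) ^ 2 =
      (I * 1 * (1 - w) - I * (1 + w) * (-1)) / (1 - w) ^ 2 := by ring
  rw [h3]
  exact h1.div h2 hw

theorem invCayley_im (w : ℂ) : (invCayley w).im = (1 - ‖w‖ ^ 2) / ‖1 - w‖ ^ 2 := by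
  rw [invCayley, Complex.div_im, ← Complex.normSq_eq_norm_sq, ← Complex.normSq_eq_norm_sq,
    ← sub_div, Complex.normSq_apply w]
  congr 1
  simp
  ring

theorem cayleySq_invCayley {w : ℂ} (hw : 1 - w ≠ 0) : cayleySq (invCayley w) = ‖w‖ ^ 2 := by
  have h1 : invCayley w - I = 2 * I * w / (1 - w) := by
    rw [invCayley]; field_simp; ring
  have h2 : invCayley w + I = 2 * I / (1 - w) := by
    rw [invCayley]; field_simp; ring
  have h3 : ‖1 - w‖ ≠ 0 := by simpa using hw
  rw [cayleySq, h1, h2]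
  simp
  field_simp

theorem injOn_invCayley : InjOn invCayley (Metric.ball 0 1) := by
  intro a ha b hb h
  have ha' := one_sub_ne_zero_of_mem_ball ha
  have hb' := one_sub_ne_zero_of_mem_ball hb
  rw [invCayley, invCayley, div_eq_div_iff ha' hb'] at h
  have h2 : I * (2 * (a - b)) = 0 := by linear_combination h
  simpa [sub_eq_zero] using h2

theorem image_invCayley :
    invCayley '' Metric.ball 0 1 = range (UpperHalfPlane.coe) := by
  ext z
  constructor
  · rintro ⟨w, hw, rfl⟩
    have h : 0 < (invCayley w).im := by
      rw [invCayley_im]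
      have h1 : 0 < ‖1 - w‖ := by simpa using one_sub_ne_zero_of_mem_ball hw
      have h2 : ‖w‖ < 1 := by simpa using hw
      have : 0 < 1 - ‖w‖ ^ 2 := by nlinarith [norm_nonneg w]
      positivity
    exact ⟨⟨_, h⟩, rfl⟩
  · rintro ⟨τ, rfl⟩
    have h := add_I_ne_zero τ
    refine ⟨((τ : ℂ) - I) / (τ + I), ?_, ?_⟩
    · have h1 := cayleySq_lt_one τ
      rw [cayleySq, ← div_pow, ← norm_div] at h1
      rw [mem_ball_zero_iff]
      nlinarith [norm_nonneg (((τ : ℂ) - I) / (τ + I))]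
    · have h2 : 1 - ((τ : ℂ) - I) / (τ + I) = 2 * I / (τ + I) := by field_simp; ring
      have h3 : 1 + ((τ : ℂ) - I) / (τ + I) = 2 * τ / (τ + I) := by field_simp; ring
      rw [invCayley, h2, h3]
      field_simp

theorem lintegral_upperHalfPlane {g : ℂ → ℝ≥0∞} (hg : Measurable g) :
    ∫⁻ τ : ℍ, g τ = ∫⁻ z in range UpperHalfPlane.coe, ENNReal.ofReal ((z.im ^ 2)⁻¹) * g z := by
  have hm : MeasurePreserving UpperHalfPlane.coe (volume.comap UpperHalfPlane.coe)
      ((volume : Measure ℂ).restrict (range UpperHalfPlane.coe)) :=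
    ⟨UpperHalfPlane.measurable_coe,
      by rw [UpperHalfPlane.measurableEmbedding_coe.map_comap]⟩
  rw [← hm.lintegral_comp_emb UpperHalfPlane.measurableEmbedding_coe, UpperHalfPlane.volume_def,
    lintegral_withDensity_eq_lintegral_mul₀]
  · refine lintegral_congr fun τ => ?_
    simp only [Pi.mul_apply]
    congr 1
    rw [← ENNReal.ofReal_coe_nnreal]
    congr 1
    simp
  · refine Measurable.aemeasurable ?_
    refine Measurable.coe_nnreal_ennreal (Measurable.pow_const ?_ 2)
    refine Measurable.div measurable_const (Continuous.measurable ?_)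
    exact UpperHalfPlane.continuous_im.subtype_mk _
  · exact (hg.comp UpperHalfPlane.measurable_coe).aemeasurable

/-- The Jacobian `4 / |1 - w|⁴` of the inverse Cayley transform meets `(Im)⁻² = |1 - w|⁴ / (1 -
|w|²)²`; the powers of `|1 - w|` cancel and a radial density remains. -/
theorem lintegral_cayleySq_eq_disc {g : ℝ → ℝ≥0∞} (hg : Measurable g) :
    ∫⁻ τ : ℍ, g (cayleySq τ) =
      ∫⁻ w in Metric.ball (0 : ℂ) 1, ENNReal.ofReal (4 * ((1 - ‖w‖ ^ 2) ^ 2)⁻¹) * g (‖w‖ ^ 2) := by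
  rw [lintegral_upperHalfPlane (g := fun z => g (cayleySq z)) (hg.comp measurable_cayleySq), ← image_invCayley,
    lintegral_image_eq_lintegral_abs_det_fderiv_mul volume Metric.isOpen_ball.measurableSet
      (fun w hw => ((hasDerivAt_invCayley
        (one_sub_ne_zero_of_mem_ball hw)).hasFDerivAt.restrictScalars ℝ).hasFDerivWithinAt)
      injOn_invCayley]
  refine setLIntegral_congr_fun Metric.isOpen_ball.measurableSet fun w hw => ?_
  have h := one_sub_ne_zero_of_mem_ball hw
  have h1 : ‖1 - w‖ ≠ 0 := by simpa using h
  simp only [cayleySq_invCayley h, invCayley_im]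
  rw [← mul_assoc, ← ENNReal.ofReal_mul (abs_nonneg _)]
  congr 2
  -- The real determinant of multiplication by a complex number is its norm from `ℂ` to `ℝ`, the
  -- squared modulus.
  have hdet : ((ContinuousLinearMap.toSpanSingleton ℂ (2 * I / (1 - w) ^ 2)).restrictScalars ℝ).det
      = ‖2 * I / (1 - w) ^ 2‖ ^ 2 := by
    rw [ContinuousLinearMap.det]
    have : ((ContinuousLinearMap.toSpanSingleton ℂ
        (2 * I / (1 - w) ^ 2)).restrictScalars ℝ : ℂ →ₗ[ℝ] ℂ) =
        (ContinuousLinearMap.toSpanSingleton ℂ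
        (2 * I / (1 - w) ^ 2) : ℂ →ₗ[ℂ] ℂ).restrictScalars ℝ := rfl
    rw [this, LinearMap.det_restrictScalars]
    simp [Algebra.norm_complex_apply, Complex.normSq_eq_norm_sq, div_pow]
  rw [hdet, abs_of_nonneg (by positivity)]
  simp
  field_simp
  norm_num

/-- Polar coordinates followed by `x = r²`: the angle contributes `2π`, and `2r dr = dx` absorbs the
factor 2. -/
theorem lintegral_ball_norm_sq {g : ℝ → ℝ≥0∞} (hg : Measurable g) :
    ∫⁻ w in Metric.ball (0 : ℂ) 1, g (‖w‖ ^ 2) =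
      ENNReal.ofReal Real.pi * ∫⁻ x in Ioo (0 : ℝ) 1, g x := by
  rw [← lintegral_indicator Metric.isOpen_ball.measurableSet,
    ← Complex.lintegral_comp_polarCoord_symm, polarCoord_target,
    Measure.volume_eq_prod, ← Measure.prod_restrict]
  have hsub : ∫⁻ x in Ioo (0 : ℝ) 1, g x =
      ∫⁻ r in Ioo (0 : ℝ) 1, ENNReal.ofReal (2 * r) * g (r ^ 2) := by
    have himg : (fun r : ℝ => r ^ 2) '' Ioo 0 1 = Ioo 0 1 := by
      ext x
      constructor
      · rintro ⟨r, ⟨h0, h1⟩, rfl⟩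
        exact ⟨by positivity, by simp only; nlinarith⟩
      · rintro ⟨h0, h1⟩
        exact ⟨√x, ⟨Real.sqrt_pos.2 h0, by rw [Real.sqrt_lt' one_pos]; simpa⟩,
          Real.sq_sqrt h0.le⟩
    conv_lhs => rw [← himg]
    refine lintegral_image_eq_lintegral_deriv_mul_of_monotoneOn measurableSet_Ioo
      (f' := fun r => 2 * r) (fun r _ => ?_) (fun a ha b _ hab => ?_) g
    · simpa using (hasDerivAt_pow 2 r).hasDerivWithinAt
    · exact pow_le_pow_left₀ ha.1.le hab 2
  have hpt : ∀ q : ℝ × ℝ,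
      ENNReal.ofReal q.1 • (Metric.ball (0 : ℂ) 1).indicator (fun w => g (‖w‖ ^ 2))
        (Complex.polarCoord.symm q) =
      ENNReal.ofReal q.1 * (Ioo (0 : ℝ) 1).indicator (fun r => g (r ^ 2)) q.1 := by
    intro q
    rcases le_or_gt q.1 0 with h | h
    · simp [ENNReal.ofReal_of_nonpos h]
    · simp only [indicator, mem_ball_zero_iff, Complex.norm_polarCoord_symm, abs_of_pos h, mem_Ioo,
        h, true_and, smul_eq_mul]
  simp only [hpt]
  rw [lintegral_prod _ (by
    refine Measurable.aemeasurable (Measurable.mul (by fun_prop) ?_)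
    exact (Measurable.indicator (hg.comp (by fun_prop)) measurableSet_Ioo).comp measurable_fst)]
  simp only [lintegral_const, Measure.restrict_apply_univ, Real.volume_Ioo]
  have hg2 : Measurable fun r : ℝ => g (r ^ 2) := hg.comp (by fun_prop)
  have hg3 : Measurable fun r : ℝ =>
      ENNReal.ofReal r * (Ioo (0 : ℝ) 1).indicator (fun r => g (r ^ 2)) r :=
    Measurable.mul (by fun_prop) (hg2.indicator measurableSet_Ioo)
  have hg4 : Measurable fun r : ℝ => ENNReal.ofReal r * g (r ^ 2) :=
    Measurable.mul (by fun_prop) hg2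
  rw [lintegral_mul_const _ hg3, hsub]
  have h2 : ∀ r : ℝ, ENNReal.ofReal r * (Ioo (0 : ℝ) 1).indicator (fun r => g (r ^ 2)) r =
      (Ioo (0 : ℝ) 1).indicator (fun r => ENNReal.ofReal r * g (r ^ 2)) r := by
    intro r
    simp only [indicator]
    split_ifs <;> simp
  simp only [h2]
  rw [lintegral_indicator measurableSet_Ioo, Measure.restrict_restrict measurableSet_Ioo,
    inter_eq_self_of_subset_left Ioo_subset_Ioi_self]
  simp only [ENNReal.ofReal_mul zero_le_two, mul_assoc]
  rw [lintegral_const_mul _ hg4, ← mul_assoc,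
    ← ENNReal.ofReal_mul Real.pi_pos.le, mul_comm]
  congr 2
  ring

/-- The integral over the upper half-plane of a function of the hyperbolic distance to `i`. -/
theorem lintegral_cayleySq {g : ℝ → ℝ≥0∞} (hg : Measurable g) :
    ∫⁻ τ : ℍ, g (cayleySq τ) =
      ENNReal.ofReal Real.pi *
        ∫⁻ x in Ioo (0 : ℝ) 1, ENNReal.ofReal (4 * ((1 - x) ^ 2)⁻¹) * g x := by
  rw [lintegral_cayleySq_eq_disc hg, ← lintegral_ball_norm_sq
    (g := fun x => ENNReal.ofReal (4 * ((1 - x) ^ 2)⁻¹) * g x)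
    (Measurable.mul (by fun_prop) hg)]

/-! ### Displacement of `i` and disjointness of translated discs -/

theorem cosh_dist_I_smul_I (γ : SL(2, ℤ)) :
    Real.cosh (dist UpperHalfPlane.I (γ • UpperHalfPlane.I)) =
      ((γ 0 0 : ℝ) ^ 2 + (γ 0 1 : ℝ) ^ 2 + (γ 1 0 : ℝ) ^ 2 + (γ 1 1 : ℝ) ^ 2) / 2 := by
  have hdet : (γ 0 0 : ℝ) * γ 1 1 - γ 0 1 * γ 1 0 = 1 := by
    have := γ.det_coe
    rw [Matrix.det_fin_two] at this
    exact_mod_cast this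
  have hj : (γ 1 0 : ℂ) * I + (γ 1 1 : ℂ) ≠ 0 := j_ne_zero γ UpperHalfPlane.I
  have hcoe : ((γ • UpperHalfPlane.I : ℍ) : ℂ) =
      ((γ 0 0 : ℂ) * I + γ 0 1) / ((γ 1 0 : ℂ) * I + γ 1 1) := by
    rw [UpperHalfPlane.coe_specialLinearGroup_apply]
    simp
  have hn : ‖(γ 1 0 : ℂ) * I + γ 1 1‖ ^ 2 = (γ 1 0 : ℝ) ^ 2 + (γ 1 1 : ℝ) ^ 2 := by
    rw [← Complex.normSq_eq_norm_sq, Complex.normSq_apply]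
    simp
    ring
  have hpos : 0 < (γ 1 0 : ℝ) ^ 2 + (γ 1 1 : ℝ) ^ 2 := by
    rw [← hn]
    positivity
  have him : (γ • UpperHalfPlane.I : ℍ).im = 1 / ((γ 1 0 : ℝ) ^ 2 + (γ 1 1 : ℝ) ^ 2) := by
    rw [← UpperHalfPlane.coe_im, hcoe, Complex.div_im, Complex.normSq_eq_norm_sq, hn, ← sub_div]
    congr 1
    simp
    linarith
  have hsub : I - ((γ 0 0 : ℂ) * I + γ 0 1) / ((γ 1 0 : ℂ) * I + γ 1 1) =
      ((((-(γ 1 0) - γ 0 1 : ℝ) : ℂ)) + ((γ 1 1 - γ 0 0 : ℝ) : ℂ) * I) /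
        ((γ 1 0 : ℂ) * I + γ 1 1) := by
    rw [eq_div_iff hj, sub_mul, div_mul_cancel₀ _ hj]
    push_cast
    linear_combination (γ 1 0 : ℂ) * I_sq
  rw [UpperHalfPlane.cosh_dist, hcoe, him, Complex.dist_eq, UpperHalfPlane.coe_I, hsub, norm_div,
    div_pow, hn, ← Complex.normSq_eq_norm_sq, Complex.normSq_add_mul_I, UpperHalfPlane.I_im]
  field_simp
  linarith

theorem cosh_dist_I (τ : ℍ) :
    Real.cosh (dist UpperHalfPlane.I τ) = (1 + cayleySq τ) / (1 - cayleySq τ) := by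
  have h := one_sub_cayleySq τ
  have h1 : ‖(τ : ℂ) + I‖ ^ 2 ≠ 0 := by simpa using add_I_ne_zero τ
  have h2 := τ.im_pos.ne'
  rw [h, UpperHalfPlane.cosh_dist, cayleySq, Complex.dist_eq, norm_sub_rev,
    UpperHalfPlane.coe_I, UpperHalfPlane.I_im]
  have hkey : ‖(τ : ℂ) + I‖ ^ 2 = ‖(τ : ℂ) - I‖ ^ 2 + 4 * τ.im := by
    rw [← Complex.normSq_eq_norm_sq, ← Complex.normSq_eq_norm_sq, Complex.normSq_apply,
      Complex.normSq_apply]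
    simp
    ring
  rw [one_add_div h1, div_div_div_cancel_right₀ h1, hkey]
  field_simp
  ring

/-- Both off-diagonal entries are multiples of `N`. If exactly one vanishes, then `ad = 1` and the
diagonal contributes 2; if neither does, they already give `2N² ≥ N² + 2`; if both do, the matrix is
`±I`. -/
theorem sq_le_of_mem_sup_Gamma {N : ℕ} (hN : 2 ≤ N) {γ : SL(2, ℤ)}
    (hγ : γ ∈ Subgroup.zpowers (-1 : SL(2, ℤ)) ⊔ CongruenceSubgroup.Gamma N)
    (hne : γ ∉ Subgroup.zpowers (-1 : SL(2, ℤ))) :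
    (N : ℤ) ^ 2 + 2 ≤ γ 0 0 ^ 2 + γ 0 1 ^ 2 + γ 1 0 ^ 2 + γ 1 1 ^ 2 := by
  have hdet : γ 0 0 * γ 1 1 - γ 0 1 * γ 1 0 = 1 := by
    have := γ.det_coe
    rwa [Matrix.det_fin_two] at this
  have hdvd : (N : ℤ) ∣ γ 0 1 ∧ (N : ℤ) ∣ γ 1 0 := by
    have := CongruenceSubgroup.Gamma_normal N
    obtain ⟨y, hy, z, hz, rfl⟩ := Subgroup.mem_sup_of_normal_right.1 hγ
    obtain ⟨n, rfl⟩ := hy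
    rw [CongruenceSubgroup.Gamma_mem] at hz
    have h01 := (ZMod.intCast_zmod_eq_zero_iff_dvd _ _).1 hz.2.1
    have h10 := (ZMod.intCast_zmod_eq_zero_iff_dvd _ _).1 hz.2.2.1
    rcases Int.even_or_odd n with he | ho
    · simpa [he.neg_one_zpow] using ⟨h01, h10⟩
    · simpa [ho.neg_one_zpow] using ⟨h01, h10⟩
  have hsq : ∀ x : ℤ, (N : ℤ) ∣ x → x ≠ 0 → (N : ℤ) ^ 2 ≤ x ^ 2 := fun x hx h0 => by
    have := Int.le_of_dvd (abs_pos.2 h0) ((dvd_abs _ _).2 hx)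
    rw [← sq_abs x]
    exact pow_le_pow_left₀ (by positivity) this 2
  have hN' : (2 : ℤ) ≤ N := by exact_mod_cast hN
  by_cases hb : γ 0 1 = 0
  · have had : γ 0 0 * γ 1 1 = 1 := by rw [hb] at hdet; linarith
    have hsq2 : γ 0 0 ^ 2 = 1 ∧ γ 1 1 ^ 2 = 1 := by
      rcases Int.mul_eq_one_iff_eq_one_or_neg_one.1 had with ⟨h1, h2⟩ | ⟨h1, h2⟩ <;> simp [h1, h2]
    by_cases hc : γ 1 0 = 0
    · exfalso
      apply hne
      rw [Subgroup.mem_zpowers_iff]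
      rcases Int.mul_eq_one_iff_eq_one_or_neg_one.1 had with ⟨h1, h2⟩ | ⟨h1, h2⟩
      · refine ⟨0, ?_⟩
        ext a b
        fin_cases a <;> fin_cases b <;> simp [h1, h2, hb, hc]
      · refine ⟨1, ?_⟩
        ext a b
        fin_cases a <;> fin_cases b <;> simp [h1, h2, hb, hc]
    · have := hsq _ hdvd.2 hc
      rw [hb, hsq2.1, hsq2.2]
      linarith
  · have h1 := hsq _ hdvd.1 hb
    by_cases hc : γ 1 0 = 0
    · have had : γ 0 0 * γ 1 1 = 1 := by rw [hc] at hdet; linarith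
      have hsq2 : γ 0 0 ^ 2 = 1 ∧ γ 1 1 ^ 2 = 1 := by
        rcases Int.mul_eq_one_iff_eq_one_or_neg_one.1 had with ⟨h1, h2⟩ | ⟨h1, h2⟩ <;>
          simp [h1, h2]
      rw [hc, hsq2.1, hsq2.2]
      linarith
    · have h2 := hsq _ hdvd.2 hc
      nlinarith [sq_nonneg (γ 0 0), sq_nonneg (γ 1 1)]

/-- A hyperbolic disc around `i` of radius bounded in terms of `N` meets its translates by
elements of `⟨-I⟩Γ(N)` only trivially. -/
theorem mem_zpowers_of_cayleySq_lt {N : ℕ} (hN : 2 ≤ N) {R : ℝ} (hR1 : R < 1)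
    (hR : 8 * R / (1 - R) ^ 2 ≤ (N : ℝ) ^ 2 / 2) {γ : SL(2, ℤ)}
    (hγ : γ ∈ Subgroup.zpowers (-1 : SL(2, ℤ)) ⊔ CongruenceSubgroup.Gamma N)
    {τ : ℍ} (h1 : cayleySq τ < R) (h2 : cayleySq (γ • τ : ℍ) < R) :
    γ ∈ Subgroup.zpowers (-1 : SL(2, ℤ)) := by
  by_contra hne
  have hS := sq_le_of_mem_sup_Gamma hN hγ hne
  have hS' : (N : ℝ) ^ 2 + 2 ≤
      (γ 0 0 : ℝ) ^ 2 + (γ 0 1 : ℝ) ^ 2 + (γ 1 0 : ℝ) ^ 2 + (γ 1 1 : ℝ) ^ 2 := by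
    exact_mod_cast hS
  have hc := cosh_dist_I_smul_I γ
  have hlt : ∀ z : ℍ, cayleySq z < R →
      Real.cosh (dist UpperHalfPlane.I z) < (1 + R) / (1 - R) := fun z hz => by
    rw [cosh_dist_I, div_lt_div_iff₀ (by linarith) (by linarith)]
    nlinarith
  -- `D` is the larger of the two distances, so it keeps the strict bound and serves for both
  -- points.
  obtain ⟨D, hD0, hD, hD1, hD2⟩ : ∃ D : ℝ, 0 ≤ D ∧ Real.cosh D < (1 + R) / (1 - R) ∧
      dist UpperHalfPlane.I τ ≤ D ∧ dist UpperHalfPlane.I (γ • τ) ≤ D := by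
    rcases le_total (dist UpperHalfPlane.I τ) (dist UpperHalfPlane.I (γ • τ)) with h | h
    · exact ⟨_, dist_nonneg, hlt _ h2, h, le_rfl⟩
    · exact ⟨_, dist_nonneg, hlt _ h1, le_rfl, h⟩
  have htri : dist UpperHalfPlane.I (γ • UpperHalfPlane.I) ≤ 2 * D := by
    have h3 : dist (γ • τ) (γ • UpperHalfPlane.I) = dist τ UpperHalfPlane.I :=
      dist_smul (Matrix.SpecialLinearGroup.map (Int.castRingHom ℝ) γ) τ UpperHalfPlane.I
    have := dist_triangle UpperHalfPlane.I (γ • τ) (γ • UpperHalfPlane.I)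
    rw [h3, dist_comm τ] at this
    linarith
  have hcosh : Real.cosh (dist UpperHalfPlane.I (γ • UpperHalfPlane.I)) ≤ Real.cosh (2 * D) :=
    Real.cosh_le_cosh.2 (by rwa [abs_of_nonneg dist_nonneg, abs_of_nonneg (by linarith)])
  rw [Real.cosh_two_mul, Real.sinh_sq] at hcosh
  have hsq : Real.cosh D ^ 2 < ((1 + R) / (1 - R)) ^ 2 :=
    pow_lt_pow_left₀ hD (Real.cosh_pos D).le two_ne_zero
  -- With `cosh 2D = 2 cosh² D - 1` this gives `cosh 2D < 1 + 8R / (1 - R)² ≤ 1 + N²/2`, against the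
  -- lower bound on `cosh d(i, γ.i)`.
  have hid : ((1 + R) / (1 - R)) ^ 2 = 1 + 4 * R / (1 - R) ^ 2 := by
    have : 1 - R ≠ 0 := by linarith
    field_simp
    ring
  have hid2 : 8 * R / (1 - R) ^ 2 = 2 * (4 * R / (1 - R) ^ 2) := by ring
  linarith

/-! ### Norms of the terms and the inequality at a zero -/

/-- No convergence has to be known beforehand: if the remaining norms have infinite sum the bound is
trivial, and otherwise the family is summable, so the vanishing of `∑'` is a genuine identity rather
than the default value. -/
theorem enorm_le_tsum_of_tsum_eq_zero {E ι : Type*} [NormedAddCommGroup E] [CompleteSpace E]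
    (s : ι → E) (i₀ : ι) (h : ∑' i, s i = 0) :
    ‖s i₀‖ₑ ≤ ∑' i : {i // i ∉ ({i₀} : Finset ι)}, ‖s i‖ₑ := by
  by_cases hf : ∑' i : {i // i ∉ ({i₀} : Finset ι)}, ‖s i‖ₑ = ∞
  · simp [hf]
  · have h1 : Summable fun i : {i // i ∉ ({i₀} : Finset ι)} => ‖s i‖₊ :=
      ENNReal.tsum_coe_ne_top_iff_summable.1 hf
    have h2 : Summable fun i : {i // i ∉ ({i₀} : Finset ι)} => s i := h1.of_nnnorm
    have h3 : Summable s := (Finset.summable_compl_iff {i₀}).1 h2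
    have h4 := h3.sum_add_tsum_subtype_compl {i₀}
    rw [h, Finset.sum_singleton] at h4
    rw [eq_neg_of_add_eq_zero_left h4, enorm_neg]
    exact enorm_tsum_le_tsum_enorm

theorem norm_toLp_mulVec {p : ℕ} {A : Matrix (Fin p) (Fin p) ℂ}
    (hA : A ∈ Matrix.unitaryGroup (Fin p) ℂ) (x : Fin p → ℂ) :
    ‖WithLp.toLp 2 (A.mulVec x)‖ = ‖WithLp.toLp 2 x‖ := by
  have key : ∀ y : Fin p → ℂ, ‖WithLp.toLp 2 y‖ ^ 2 = (star y ⬝ᵥ y).re := fun y => by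
    rw [EuclideanSpace.norm_sq_eq, dotProduct, Complex.re_sum]
    refine Finset.sum_congr rfl fun i _ => ?_
    simp [Complex.mul_re, ← Complex.normSq_eq_norm_sq, Complex.normSq_apply]
  have h : star (A.mulVec x) ⬝ᵥ A.mulVec x = star x ⬝ᵥ x := by
    rw [Matrix.star_mulVec, Matrix.dotProduct_mulVec, Matrix.vecMul_vecMul,
      ← Matrix.star_eq_conjTranspose, Matrix.mem_unitaryGroup_iff'.1 hA, Matrix.vecMul_one]
  rw [← sq_eq_sq₀ (norm_nonneg _) (norm_nonneg _), key, key, h]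

/-- The absolute value of the seed, normalized so that the slash action on it becomes the
action on the argument. -/
noncomputable def seedWeight (k : ℝ) {p : ℕ} (ν : ℕ) (u : Fin p → ℂ) (τ : ℍ) : ℝ :=
  ‖WithLp.toLp 2 (ellipticSeed k ν UpperHalfPlane.I u τ)‖ * τ.im ^ (k / 2)

/-- The factor `|j|^(-k)` of the slash action is absorbed by `Im(γ.τ) = Im τ / |j|²`. The Euclidean
norm is used because unitary matrices preserve it. -/
theorem norm_slashRep_mul {k : ℝ} {v : SL(2, ℤ) → ℂ} (hv : IsUnitaryMultiplierSystem k v) {p : ℕ}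
    {Γ : Subgroup SL(2, ℤ)} {ρ : Γ →* GL (Fin p) ℂ} (hρ : IsUnitaryRep ρ) (ν : ℕ)
    (u : Fin p → ℂ) (γ : Γ) (τ : ℍ) :
    ‖WithLp.toLp 2 (slashRep k v ρ (ellipticSeed k ν UpperHalfPlane.I u) γ τ)‖ * τ.im ^ (k / 2) =
      seedWeight k ν u ((γ : SL(2, ℤ)) • τ) := by
  have hU : (((ρ γ)⁻¹ : GL (Fin p) ℂ) : Matrix (Fin p) (Fin p) ℂ) ∈
      Matrix.unitaryGroup (Fin p) ℂ := by
    rw [← map_inv]; exact hρ γ⁻¹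
  have hj : 0 < ‖j γ τ‖ := norm_pos_iff.2 (j_ne_zero _ _)
  have him : ((γ : SL(2, ℤ)) • τ : ℍ).im = τ.im / ‖j γ τ‖ ^ 2 := by
    rw [ModularGroup.im_smul_eq_div_normSq, Complex.normSq_eq_norm_sq]
    rfl
  have hpow : (‖j γ τ‖ ^ 2) ^ (k / 2) = ‖j γ τ‖ ^ k := by
    rw [← Real.rpow_natCast, ← Real.rpow_mul hj.le]
    congr 1
    push_cast
    ring
  rw [slashRep, norm_toLp_mulVec hU, slash, seedWeight, him, WithLp.toLp_smul, norm_smul, norm_mul,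
    norm_inv, hv.norm_eq_one, ← Complex.ofReal_neg, Complex.norm_cpow_real,
    Real.div_rpow τ.im_pos.le (by positivity), hpow, Real.rpow_neg hj.le]
  ring

/-- The factor `(Im τ / |τ + i|²)^(k/2)` is `((1 - t) / 4)^(k/2)` by `one_sub_cayleySq`. The branch
of the power is immaterial: the exponent is real, so only the modulus of the base enters. -/
theorem seedWeight_eq (k : ℝ) {p : ℕ} (ν : ℕ) (u : Fin p → ℂ) (τ : ℍ) :
    seedWeight k ν u τ = ‖WithLp.toLp 2 u‖ * (4 : ℝ)⁻¹ ^ (k / 2) *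
      (cayleySq τ ^ ((ν : ℝ) / 2) * (1 - cayleySq τ) ^ (k / 2)) := by
  have hI : (τ : ℂ) - (starRingEnd ℂ) ((UpperHalfPlane.I : ℍ) : ℂ) = τ + I := by simp
  have hpos : 0 < ‖(τ : ℂ) + I‖ := by simpa using add_I_ne_zero τ
  have hcast : ((ν : ℂ) + (k : ℂ)) = (((ν : ℝ) + k : ℝ) : ℂ) := by push_cast; rfl
  have hsq : ∀ (x s : ℝ), 0 ≤ x → (x ^ 2) ^ (s / 2) = x ^ s := fun x s hx => by
    rw [← Real.rpow_natCast, ← Real.rpow_mul hx]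
    congr 1
    push_cast
    ring
  have him := τ.im_pos.le
  rw [seedWeight, ellipticSeed, hI, WithLp.toLp_smul, norm_smul, norm_div, norm_pow, hcast,
    Complex.norm_cpow_real, one_sub_cayleySq, cayleySq, UpperHalfPlane.coe_I,
    Real.div_rpow (by positivity) (by positivity), Real.div_rpow (by positivity) (by positivity),
    hsq _ _ (norm_nonneg _), hsq _ _ hpos.le, hsq _ _ hpos.le, Real.rpow_natCast, Real.rpow_natCast,
    Real.mul_rpow (by norm_num) him, Real.inv_rpow (by norm_num), Real.rpow_add hpos,
    Real.rpow_natCast]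
  have h4 : (4 : ℝ) ^ (k / 2) ≠ 0 := (Real.rpow_pos_of_pos (by norm_num) _).ne'
  have h5 : ‖(τ : ℂ) + I‖ ^ k ≠ 0 := (Real.rpow_pos_of_pos hpos _).ne'
  field_simp

/-- At a zero of the Poincaré series each term is dominated by the others. -/
theorem seedWeight_le_tsum {k : ℝ} {v : SL(2, ℤ) → ℂ} (hv : IsUnitaryMultiplierSystem k v)
    {p : ℕ} {Γ : Subgroup SL(2, ℤ)} {ρ : Γ →* GL (Fin p) ℂ} (hρ : IsUnitaryRep ρ)
    (Λ : Subgroup Γ) (ν : ℕ) (u : Fin p → ℂ) (q₀ : Quotient (QuotientGroup.rightRel Λ)) (τ : ℍ)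
    (h0 : poincareSeries k v Λ ρ (ellipticSeed k ν UpperHalfPlane.I u) τ = 0) :
    ENNReal.ofReal (seedWeight k ν u ((q₀.out : SL(2, ℤ)) • τ)) ≤
      ∑' q : {q // q ∉ ({q₀} : Finset (Quotient (QuotientGroup.rightRel Λ)))},
        ENNReal.ofReal (seedWeight k ν u ((q.1.out : SL(2, ℤ)) • τ)) := by
  set s : Quotient (QuotientGroup.rightRel Λ) → EuclideanSpace ℂ (Fin p) := fun q =>
    WithLp.toLp 2 (slashRep k v ρ (ellipticSeed k ν UpperHalfPlane.I u) q.out τ) with hs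
  have hs0 : ∑' q, s q = 0 := by
    have := (PiLp.continuousLinearEquiv 2 ℂ (fun _ : Fin p => ℂ)).symm.map_tsum
      (L := .unconditional _)
      (f := fun q : Quotient (QuotientGroup.rightRel Λ) =>
        slashRep k v ρ (ellipticSeed k ν UpperHalfPlane.I u) q.out τ)
    rw [poincareSeries] at h0
    rw [h0, map_zero] at this
    exact this.symm
  have hterm : ∀ q, ENNReal.ofReal (seedWeight k ν u ((q.out : SL(2, ℤ)) • τ)) =
      ‖s q‖ₑ * ENNReal.ofReal (τ.im ^ (k / 2)) := fun q => by
    rw [← norm_slashRep_mul hv hρ, ENNReal.ofReal_mul (norm_nonneg _), ofReal_norm]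
  simp only [hterm]
  rw [ENNReal.tsum_mul_right]
  gcongr
  exact enorm_le_tsum_of_tsum_eq_zero s q₀ hs0

/-! ### Integration over the disc and unfolding -/

theorem measurePreserving_smul_SL (γ : SL(2, ℤ)) :
    MeasurePreserving (fun τ : ℍ => γ • τ) volume volume :=
  measurePreserving_smul (γ : GL (Fin 2) ℝ) (volume : Measure ℍ)

theorem measurable_seedWeight (k : ℝ) {p : ℕ} (ν : ℕ) (u : Fin p → ℂ) :
    Measurable (seedWeight k ν u) := by
  have h : Measurable fun τ : ℍ => cayleySq τ :=
    measurable_cayleySq.comp UpperHalfPlane.measurable_coe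
  simp only [funext (seedWeight_eq k ν u)]
  fun_prop

/-- The unnormalized density of the beta distribution. -/
noncomputable def betaDensity (a b x : ℝ) : ℝ := x ^ (a - 1) * (1 - x) ^ (b - 1)

/-- The exponent `k/2 - 2` of `1 - x` combines `k/2` from the weight with `-2` from the hyperbolic
measure. -/
theorem setLIntegral_seedWeight (k : ℝ) {p : ℕ} (ν : ℕ) (u : Fin p → ℂ) {S : Set ℝ}
    (hS : MeasurableSet S) :
    ∫⁻ τ in {τ : ℍ | cayleySq τ ∈ S}, ENNReal.ofReal (seedWeight k ν u τ) =
      ENNReal.ofReal (Real.pi * (4 * (‖WithLp.toLp 2 u‖ * (4 : ℝ)⁻¹ ^ (k / 2)))) *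
        ∫⁻ x in S ∩ Ioo 0 1, ENNReal.ofReal (betaDensity ((ν : ℝ) / 2 + 1) (k / 2 - 1) x) := by
  have hmeas : MeasurableSet {τ : ℍ | cayleySq τ ∈ S} :=
    (measurable_cayleySq.comp UpperHalfPlane.measurable_coe) hS
  set C : ℝ := ‖WithLp.toLp 2 u‖ * (4 : ℝ)⁻¹ ^ (k / 2) with hC
  have hC0 : 0 ≤ C := mul_nonneg (norm_nonneg _) (Real.rpow_nonneg (by norm_num) _)
  set g : ℝ → ℝ≥0∞ := fun x => ENNReal.ofReal (C * (x ^ ((ν : ℝ) / 2) * (1 - x) ^ (k / 2)))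
    with hg
  have hgm : Measurable g := by rw [hg]; fun_prop
  have hbm : Measurable fun x => ENNReal.ofReal (betaDensity ((ν : ℝ) / 2 + 1) (k / 2 - 1) x) := by
    unfold betaDensity; fun_prop
  rw [← lintegral_indicator hmeas]
  have h1 : ∀ τ : ℍ, ({τ : ℍ | cayleySq τ ∈ S}.indicator
      fun τ => ENNReal.ofReal (seedWeight k ν u τ)) τ = S.indicator g (cayleySq τ) := fun τ => by
    simp only [indicator, seedWeight_eq, hg]
    rfl
  simp only [h1]
  rw [lintegral_cayleySq (hgm.indicator hS), ENNReal.ofReal_mul Real.pi_pos.le, mul_assoc,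
    ← Measure.restrict_restrict hS, ← lintegral_indicator hS,
    ← lintegral_const_mul _ (hbm.indicator hS)]
  congr 1
  refine setLIntegral_congr_fun measurableSet_Ioo fun x hx => ?_
  simp only [indicator]
  split_ifs with hxS
  · have h1x : 0 < 1 - x := by linarith [hx.2]
    rw [hg, ← ENNReal.ofReal_mul (by positivity), ← ENNReal.ofReal_mul (by positivity)]
    congr 1
    have e1 : (ν : ℝ) / 2 + 1 - 1 = (ν : ℝ) / 2 := by ring
    have e2 : (1 - x) ^ (k / 2 - 1 - 1) = (1 - x) ^ (k / 2) * ((1 - x) ^ 2)⁻¹ := by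
      rw [show k / 2 - 1 - 1 = k / 2 - (2 : ℕ) by push_cast; ring, Real.rpow_sub h1x,
        Real.rpow_natCast]
      rfl
    rw [betaDensity, e1, e2]
    ring
  · simp

theorem smul_eq_of_mem_zpowers_neg_one {γ : SL(2, ℤ)}
    (h : γ ∈ Subgroup.zpowers (-1 : SL(2, ℤ))) (τ : ℍ) : γ • τ = τ := by
  obtain ⟨n, rfl⟩ := h
  rcases Int.even_or_odd n with he | ho
  · simp [he.neg_one_zpow]
  · simp only [ho.neg_one_zpow]
    ext
    simp

/-- Invariance of the measure turns the integral of a translated weight over the disc `A` into the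
integral of the weight over the translate `B q`. The translates for nontrivial cosets are disjoint
from each other and from `A`, so together they fit into its complement. -/
theorem lintegral_disc_le {k : ℝ} {v : SL(2, ℤ) → ℂ} (hv : IsUnitaryMultiplierSystem k v)
    {p : ℕ} {Γ : Subgroup SL(2, ℤ)} {ρ : Γ →* GL (Fin p) ℂ} (hρ : IsUnitaryRep ρ)
    (ν : ℕ) (u : Fin p → ℂ) {R : ℝ}
    (hR : ∀ γ ∈ Γ, ∀ τ : ℍ, cayleySq τ < R → cayleySq (γ • τ : ℍ) < R →
      γ ∈ Subgroup.zpowers (-1 : SL(2, ℤ)))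
    (h0 : ellipticPoincare k v ρ ν UpperHalfPlane.I u = 0) :
    ∫⁻ τ in {τ : ℍ | cayleySq τ ∈ Iio R}, ENNReal.ofReal (seedWeight k ν u τ) ≤
      ∫⁻ τ in {τ : ℍ | cayleySq τ ∈ Ici R}, ENNReal.ofReal (seedWeight k ν u τ) := by
  set Λ : Subgroup Γ := (Subgroup.zpowers (-1 : SL(2, ℤ))).subgroupOf Γ with hΛ
  set F : ℍ → ℝ≥0∞ := fun τ => ENNReal.ofReal (seedWeight k ν u τ) with hF
  have hFm : Measurable F := (measurable_seedWeight k ν u).ennreal_ofReal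
  set A : Set ℍ := {τ : ℍ | cayleySq τ ∈ Iio R} with hA
  have hAm : MeasurableSet A :=
    (measurable_cayleySq.comp UpperHalfPlane.measurable_coe) measurableSet_Iio
  let B : Quotient (QuotientGroup.rightRel Λ) → Set ℍ := fun q =>
    (fun z : ℍ => (q.out : SL(2, ℤ))⁻¹ • z) ⁻¹' A
  have hBm : ∀ q, MeasurableSet (B q) := fun q => (measurePreserving_smul_SL _).measurable hAm
  have hint : ∀ q : Quotient (QuotientGroup.rightRel Λ),
      ∫⁻ τ in A, F ((q.out : SL(2, ℤ)) • τ) = ∫⁻ z in B q, F z := fun q => by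
    have := (measurePreserving_smul_SL (q.out : SL(2, ℤ))).setLIntegral_comp_preimage (hBm q) hFm
    rw [← this]
    congr 2
    ext τ
    simp [B, inv_smul_smul]
  have hdisj : ∀ q q' : Quotient (QuotientGroup.rightRel Λ), q ≠ q' → Disjoint (B q) (B q') := by
    intro q q' hne
    rw [Set.disjoint_left]
    intro z hz hz'
    apply hne
    set γ := q.out
    set γ' := q'.out
    have hmem : ((γ'⁻¹ * γ : Γ) : SL(2, ℤ)) ∈ Subgroup.zpowers (-1 : SL(2, ℤ)) := by
      refine hR _ (γ'⁻¹ * γ).2 ((γ : SL(2, ℤ))⁻¹ • z) hz ?_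
      have : ((γ'⁻¹ * γ : Γ) : SL(2, ℤ)) • ((γ : SL(2, ℤ))⁻¹ • z) = (γ' : SL(2, ℤ))⁻¹ • z := by
        rw [Subgroup.coe_mul, mul_smul, smul_inv_smul, Subgroup.coe_inv]
      rw [this]
      exact hz'
    rw [← q.out_eq, ← q'.out_eq]
    symm
    refine Quotient.sound ?_
    change QuotientGroup.rightRel Λ γ' γ
    rw [QuotientGroup.rightRel_apply, hΛ, Subgroup.mem_subgroupOf]
    -- Disjointness yields `γ'⁻¹γ = ±I`, while equality of the cosets `Λγ` concerns `γγ'⁻¹`; the two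
    -- agree because `±I` is central.
    have hcomm : Commute ((γ'⁻¹ * γ : Γ) : SL(2, ℤ)) (γ' : SL(2, ℤ)) := by
      obtain ⟨n, hn⟩ := hmem
      rw [← hn]
      exact (Commute.neg_one_left _).zpow_left n
    have heq : ((γ * γ'⁻¹ : Γ) : SL(2, ℤ)) = ((γ'⁻¹ * γ : Γ) : SL(2, ℤ)) := by
      have h2 := hcomm.eq
      simp only [Subgroup.coe_mul, Subgroup.coe_inv] at h2 ⊢
      rw [mul_inv_cancel_left] at h2
      exact mul_inv_eq_iff_eq_mul.2 h2.symm
    rw [heq]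
    exact hmem
  have : Countable SL(2, ℤ) :=
    have : Countable (Matrix (Fin 2) (Fin 2) ℤ) :=
      inferInstanceAs (Countable (Fin 2 → Fin 2 → ℤ))
    Subtype.countable
  have : Countable (Quotient (QuotientGroup.rightRel Λ)) := Quotient.countable
  let q₀ : Quotient (QuotientGroup.rightRel Λ) := Quotient.mk _ 1
  -- The chosen representative of the trivial coset may be `-I`, which still acts trivially on `ℍ`.
  have hq₀ : (q₀.out : SL(2, ℤ)) ∈ Subgroup.zpowers (-1 : SL(2, ℤ)) := by
    have h := QuotientGroup.rightRel_apply.1 (Quotient.mk_out (s := QuotientGroup.rightRel Λ) 1)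
    rw [one_mul, hΛ, inv_mem_iff, Subgroup.mem_subgroupOf] at h
    exact h
  have hB₀ : B q₀ = A := by
    ext z
    simp only [B, mem_preimage, smul_eq_of_mem_zpowers_neg_one (inv_mem hq₀)]
  have hcompl : {τ : ℍ | cayleySq τ ∈ Ici R} = Aᶜ := by
    ext; simp [hA]
  calc ∫⁻ τ in A, F τ = ∫⁻ τ in A, F ((q₀.out : SL(2, ℤ)) • τ) := by
        rw [hint, hB₀]
    _ ≤ ∫⁻ τ in A, ∑' q : {q // q ∉ ({q₀} : Finset (Quotient (QuotientGroup.rightRel Λ)))},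
          F ((q.1.out : SL(2, ℤ)) • τ) :=
        lintegral_mono fun τ => seedWeight_le_tsum hv hρ Λ ν u q₀ τ (congrFun h0 τ)
    _ = ∑' q : {q // q ∉ ({q₀} : Finset (Quotient (QuotientGroup.rightRel Λ)))},
          ∫⁻ z in B q, F z := by
        simp only [← hint]
        exact lintegral_tsum fun q =>
          (hFm.comp (measurePreserving_smul_SL (q.1.out : SL(2, ℤ))).measurable).aemeasurable
    _ = ∫⁻ z in ⋃ q : {q // q ∉ ({q₀} : Finset (Quotient (QuotientGroup.rightRel Λ)))}, B q,
          F z :=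
        (lintegral_iUnion
          (s := fun q : {q // q ∉ ({q₀} : Finset (Quotient (QuotientGroup.rightRel Λ)))} => B q)
          (fun q => hBm q) (fun q q' h => hdisj q q' fun e => h (Subtype.ext e)) _).symm
    _ ≤ ∫⁻ τ in {τ : ℍ | cayleySq τ ∈ Ici R}, F τ := by
        refine lintegral_mono_set ?_
        rw [hcompl, ← hB₀]
        refine iUnion_subset fun q => (hdisj _ _ ?_).subset_compl_right
        simpa using q.2

/-! ### The beta median and the choice of the radius -/

theorem betaDensity_pos {a b x : ℝ} (h0 : 0 < x) (h1 : x < 1) : 0 < betaDensity a b x :=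
  mul_pos (Real.rpow_pos_of_pos h0 _) (Real.rpow_pos_of_pos (by linarith) _)

/-- Moving the cut from the median to `R` shifts the positive mass of `(m, R)` to the left side. -/
theorem lintegral_betaDensity_lt {a b R : ℝ} (ha : 0 < a) (hb : 0 < b)
    (hR : betaMedian a b < R) (hR1 : R < 1) :
    ∫⁻ x in Ici R ∩ Ioo 0 1, ENNReal.ofReal (betaDensity a b x) <
      ∫⁻ x in Iio R ∩ Ioo 0 1, ENNReal.ofReal (betaDensity a b x) := by
  have hm := (isBetaMedian_iff ha hb _).2 rfl
  set m := betaMedian a b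
  have hR0 : 0 < R := hm.pos.trans hR
  have hsub : ∀ x y : ℝ, 0 ≤ x → x ≤ y → y ≤ 1 →
      IntervalIntegrable (betaDensity a b) volume x y := fun x y hx hxy hy =>
    (beta_intervalIntegrable ha hb).mono_set (by
      rw [Set.uIcc_of_le hxy, Set.uIcc_of_le zero_le_one]
      exact Set.Icc_subset_Icc hx hy)
  have hconv : ∀ x y : ℝ, 0 ≤ x → x ≤ y → y ≤ 1 →
      ∫⁻ t in Ioo x y, ENNReal.ofReal (betaDensity a b t) =
        ENNReal.ofReal (∫ t in x..y, betaDensity a b t) := fun x y hx hxy hy => by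
    rw [intervalIntegral.integral_of_le hxy, integral_Ioc_eq_integral_Ioo,
      ofReal_integral_eq_lintegral_ofReal]
    · exact ((intervalIntegrable_iff_integrableOn_Ioc_of_le hxy).1 (hsub x y hx hxy hy)).mono_set
        Ioo_subset_Ioc_self
    · exact (ae_restrict_iff' measurableSet_Ioo).2 (.of_forall fun t ht =>
        (betaDensity_pos (hx.trans_lt ht.1) (ht.2.trans_le hy)).le)
  have hpos : 0 < ∫ t in m..R, betaDensity a b t :=
    intervalIntegral.intervalIntegral_pos_of_pos_on (hsub m R hm.pos.le hR.le hR1.le)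
      (fun t ht => betaDensity_pos (hm.pos.trans ht.1) (ht.2.trans hR1)) hR
  have hpos' : 0 ≤ ∫ t in R..1, betaDensity a b t :=
    (intervalIntegral.intervalIntegral_pos_of_pos_on (hsub R 1 hR0.le hR1.le le_rfl)
      (fun t ht => betaDensity_pos (hR0.trans ht.1) ht.2) hR1).le
  have e1 := intervalIntegral.integral_add_adjacent_intervals
    (hsub 0 m le_rfl hm.pos.le hm.lt_one.le) (hsub m R hm.pos.le hR.le hR1.le)
  have e2 := intervalIntegral.integral_add_adjacent_intervals
    (hsub m R hm.pos.le hR.le hR1.le) (hsub R 1 hR0.le hR1.le le_rfl)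
  have e3 : ∫ t in (0 : ℝ)..m, betaDensity a b t = ∫ t in m..1, betaDensity a b t :=
    hm.integral_eq
  have s1 : Ici R ∩ Ioo 0 1 = Ico R 1 := by
    ext x
    simp only [mem_inter_iff, mem_Ici, mem_Ioo, mem_Ico]
    exact ⟨fun h => ⟨h.1, h.2.2⟩, fun h => ⟨h.1, hR0.trans_le h.1, h.2⟩⟩
  have s2 : Iio R ∩ Ioo 0 1 = Ioo 0 R := by
    ext x
    simp only [mem_inter_iff, mem_Iio, mem_Ioo]
    exact ⟨fun h => ⟨h.2.1, h.1⟩, fun h => ⟨h.2, h.1, h.2.trans hR1⟩⟩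
  rw [s1, s2, setLIntegral_congr Ioo_ae_eq_Ico.symm, hconv R 1 hR0.le hR1.le le_rfl,
    hconv 0 R le_rfl hR0.le hR1.le]
  exact (ENNReal.ofReal_lt_ofReal_iff (by linarith)).2 (by linarith)

/-- The squared hypothesis is the strict inequality `8m / (1 - m)² < N²/2`, which by continuity
persists slightly to the right of `m`. -/
theorem exists_radius {m N : ℝ} (hm0 : 0 < m) (hm1 : m < 1)
    (h : N > 4 * m ^ (1 / 2 : ℝ) / (1 - m)) :
    ∃ R, m < R ∧ R < 1 ∧ 8 * R / (1 - R) ^ 2 ≤ N ^ 2 / 2 := by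
  have h1m : 0 < 1 - m := by linarith
  have hsq : (4 * m ^ (1 / 2 : ℝ) / (1 - m)) ^ 2 = 16 * m / (1 - m) ^ 2 := by
    rw [div_pow, mul_pow, ← Real.sqrt_eq_rpow, Real.sq_sqrt hm0.le]
    norm_num
  have hlt : 16 * m / (1 - m) ^ 2 < N ^ 2 := by
    rw [← hsq]
    exact pow_lt_pow_left₀ h (by positivity) two_ne_zero
  have hlt2 : 8 * m / (1 - m) ^ 2 < N ^ 2 / 2 := by
    have : 16 * m / (1 - m) ^ 2 = 2 * (8 * m / (1 - m) ^ 2) := by ring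
    linarith
  have hcont : ContinuousAt (fun R : ℝ => 8 * R / (1 - R) ^ 2) m :=
    ContinuousAt.div (by fun_prop) (by fun_prop) (by positivity)
  have hev := (hcont.eventually_lt continuousAt_const hlt2).filter_mono
    (nhdsWithin_le_nhds (s := Ioi m))
  obtain ⟨R, hR, hR2⟩ := (hev.and (Ioo_mem_nhdsGT hm1)).exists
  exact ⟨R, hR2.1, hR2.2, hR.le⟩

end VVPS

theorem theorem6p3 (p : ℕ) (k : ℝ) (hk : 2 < k)
    (v : SL(2, ℤ) → ℂ) (hv : VVPS.IsUnitaryMultiplierSystem k v)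
    (N : ℕ) (hN : 2 ≤ N)
    (Γ : Subgroup SL(2, ℤ)) (hneg : (-1 : SL(2, ℤ)) ∈ Γ)
    (hle : Γ ≤ Subgroup.zpowers (-1 : SL(2, ℤ)) ⊔ CongruenceSubgroup.Gamma N)
    (hfin : Γ.IsFiniteRelIndex (Subgroup.zpowers (-1 : SL(2, ℤ)) ⊔ CongruenceSubgroup.Gamma N))
    (ρ : Γ →* GL (Fin p) ℂ) (hρn : VVPS.IsNormalRep v ρ) (hρu : VVPS.IsUnitaryRep ρ)
    (ν : ℕ) (u : Fin p → ℂ) (hu : u ≠ 0)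
    (hNM : (N : ℝ) > 4 * (VVPS.betaMedian ((ν : ℝ) / 2 + 1) (k / 2 - 1)) ^ (1 / 2 : ℝ) /
      (1 - VVPS.betaMedian ((ν : ℝ) / 2 + 1) (k / 2 - 1))) :
    VVPS.ellipticPoincare k v ρ ν UpperHalfPlane.I u ≠ 0 := by
  intro h0
  have ha : (0 : ℝ) < (ν : ℝ) / 2 + 1 := by positivity
  have hb : 0 < k / 2 - 1 := by linarith
  have hm := (VVPS.isBetaMedian_iff ha hb _).2 rfl
  obtain ⟨R, hmR, hR1, hR⟩ := VVPS.exists_radius hm.pos hm.lt_one hNM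
  have hle' := VVPS.lintegral_disc_le hv hρu ν u (R := R)
    (fun γ hγ τ h1 h2 => VVPS.mem_zpowers_of_cayleySq_lt hN hR1 hR (hle hγ) h1 h2) h0
  rw [VVPS.setLIntegral_seedWeight k ν u measurableSet_Iio,
    VVPS.setLIntegral_seedWeight k ν u measurableSet_Ici] at hle'
  have hu' : 0 < ‖WithLp.toLp 2 u‖ := by
    rw [norm_pos_iff]
    exact fun h => hu ((WithLp.toLp_eq_zero 2).1 h)
  have hC : 0 < Real.pi * (4 * (‖WithLp.toLp 2 u‖ * (4 : ℝ)⁻¹ ^ (k / 2))) := by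
    have := Real.pi_pos
    positivity
  -- The constant common to both sides is finite, and positive because `u ≠ 0`, so it cancels.
  rw [ENNReal.mul_le_mul_iff_right (ENNReal.ofReal_pos.2 hC).ne' ENNReal.ofReal_ne_top] at hle'
  exact hle'.not_gt (VVPS.lintegral_betaDensity_lt ha hb hmR hR1)
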